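/- Let $G$ be a finite connected simple graph with maximum degree at most $3$. Suppose that $G$ is outerplanar, and fix a planar drawing of $G$ in which all vertices lie on the boundary of the outer (unbounded) face; let $r\ge 0$ be the number of the other (bounded) faces of this drawing. Then $$\chi_\rho(G)\le 9\cdot 6^{r}-2 .$$ Here, for a positive integer $k$, a packing $k$-colouring of $G$ is a map $c:V(G)\to\{1,\dots,k\}$ such that any two distinct vertices $u,v$ with $c(u)=c(v)=i$ are at distance greater than $i$ in $G$, and $\chi_\rho(G)$ is the smallest $k$ for which $G$ has a packing $k$-colouring ($\infty$ if there is none). -/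

import Mathlib

namespace SimpleGraph

/-! ### Packing colourings -/

/-- A packing `k`-colouring of `G`: a map to the colours `1, …, k` such that distinct vertices of
the same colour `i` are at distance greater than `i`. The extended distance `G.edist` is `⊤` between
different connected components. -/
def IsPackingColoring {V : Type*} (G : SimpleGraph V) (k : ℕ) (c : V → ℕ) : Prop :=
  (∀ v, 1 ≤ c v ∧ c v ≤ k) ∧ ∀ u v, u ≠ v → c u = c v → (c u : ℕ∞) < G.edist u v

/-- The packing chromatic number: the least `k` such that `G` has a packing `k`-colouring, and `⊤`
if there is no such `k`. -/
noncomputable def packingChromaticNumber {V : Type*} (G : SimpleGraph V) : ℕ∞ :=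
  ⨅ k : {k : ℕ // ∃ c : V → ℕ, G.IsPackingColoring k c}, ((k : ℕ) : ℕ∞)

/-! ### Plane drawings and their faces

A drawing of a finite connected graph on an oriented closed surface whose faces are discs is
described, up to homeomorphism, by its rotation system: the cyclic order in which the darts (edges
with a direction) leave each vertex. The faces are recovered by face tracing, and the surface is
the sphere exactly when Euler's formula `|V| - |E| + |F| = 2` holds. A drawing in the plane is a
drawing on the sphere together with the choice of the face that becomes the unbounded one. -/

/-- A rotation system on `G`: a permutation of the darts that cyclically permutes, for every
vertex `v`, the darts leaving `v`. -/
structure RotationSystem {V : Type*} (G : SimpleGraph V) where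
  /-- the next dart in the rotation around the starting vertex -/
  rot : Equiv.Perm G.Dart
  fst_rot : ∀ d, (rot d).fst = d.fst
  sameCycle_rot : ∀ d e : G.Dart, d.fst = e.fst → rot.SameCycle d e

namespace RotationSystem

variable {V : Type*} {G : SimpleGraph V}

/-- Face tracing: walk along the dart `d`, and leave its end by the dart that follows the reversal
of `d` in the rotation there. -/
def next (R : RotationSystem G) : Equiv.Perm G.Dart :=
  (Dart.symm_involutive (G := G)).toPerm.trans R.rot

/-- The faces: the orbits of face tracing. A vertex without any edge has no darts; drawn alone on
a sphere it has one face around it, which is added separately. -/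
def Face (R : RotationSystem G) : Type _ :=
  Quotient (Equiv.Perm.SameCycle.setoid R.next) ⊕ {v : V // ∀ w, ¬ G.Adj v w}

/-- The vertex `v` lies on (the boundary of) the face. -/
def Face.HasVertex {R : RotationSystem G} (f : R.Face) (v : V) : Prop :=
  match f with
  | Sum.inl q => ∃ d : G.Dart, Quotient.mk (Equiv.Perm.SameCycle.setoid R.next) d = q ∧ d.fst = v
  | Sum.inr u => (u : V) = v

end RotationSystem

/-- A plane drawing of a (finite, connected) graph with all vertices on the outer face. -/
structure OuterplanarDrawing {V : Type*} (G : SimpleGraph V) extends RotationSystem G where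
  /-- Euler's formula `|V| - |E| + |F| = 2`: the drawing is on the sphere -/
  euler : Nat.card V + Nat.card toRotationSystem.Face = Nat.card G.edgeSet + 2
  /-- the face that is unbounded in the plane -/
  outer : toRotationSystem.Face
  hasVertex_outer : ∀ v, outer.HasVertex v

/-- The bounded faces of an outerplanar drawing: all faces except the outer one. -/
def OuterplanarDrawing.BoundedFace {V : Type*} {G : SimpleGraph V} (D : G.OuterplanarDrawing) :
    Type _ :=
  {f : D.toRotationSystem.Face // f ≠ D.outer}

end SimpleGraph

/-!
The outerplanarity only enters through Euler's formula: a connected graph drawn on the sphere with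
`r + 1` faces has exactly `r` edges outside any spanning tree `T`. The bound is then obtained by
correcting a packing `7`-colouring of `T` near these `r` edges.

* Every subcubic tree has a packing `7`-colouring. It comes from a finite pattern
  (`SimpleGraph.Pattern`) of coloured states: a locally injective map from a graph to the pattern
  (`SimpleGraph.IsPatternLabelling`; at the states of colours `4, …, 7` injectivity is not needed)
  gives a packing colouring, because a path between two vertices of the same colour `i` maps to a
  walk without turning back in the pattern, and a finite check shows that such a walk has length
  greater than `i`. A tree can be labelled leaf by leaf, since three neighbouring states are
  available at each state where local injectivity is required.

* If two vertices of the same colour `i ≤ 7` are too close in `G` although they are not in `T`, then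
  a path of length at most `7` between them uses an edge outside `T`, so that one of them is at
  distance at most `3` from an end of such an edge
  (`SimpleGraph.Walk.exists_walk_le_or_exists_not_adj`). A ball of radius `3` in a subcubic graph has
  at most `22` vertices, so at most `44 * r` vertices are close to an edge outside `T`. Each of these
  receives a private new colour, which gives `7 + 44 * r ≤ 9 * 6 ^ r - 2` colours in total.
-/

namespace SimpleGraph

/-! ### The pattern -/

/-- The states of the pattern from which trees are coloured. The hubs have colour `1`, and every
edge of the pattern joins a hub to another state. In a labelled cubic tree each hub sees one vertex
of colour `2`, one of colour `3` and one of colour at least `4`. A vertex of colour `2` or `3` with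
parameter `s` sees the colours `4`, `5` and one of `6` and `7` behind its three hubs, where `s`
decides between `6` and `7`. -/
inductive Pattern
  | two (s : Bool)
  | three (s : Bool)
  | four
  | five
  | high (s : Bool)
  | hubFour (s : Bool)
  | hubFive (s : Bool)
  | hubHigh (s : Bool)
  deriving DecidableEq

namespace Pattern

/-- The colour of a state. -/
def color : Pattern → ℕ
  | two _ => 2
  | three _ => 3
  | four => 4
  | five => 5
  | high false => 6
  | high true => 7
  | hubFour _ | hubFive _ | hubHigh _ => 1

/-- The neighbours of a state. At a hub of colour-`4` or colour-`5` type, the states of colours `2`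
and `3` have opposite parameters: otherwise vertices of the same colour `6` or `7`, one behind each
of these two states, would be at distance `6`. -/
def nbrs : Pattern → List Pattern
  | two s => [hubFour s, hubFive s, hubHigh s]
  | three s => [hubFour (!s), hubFive (!s), hubHigh s]
  | four => [hubFour false, hubFour true]
  | five => [hubFive false, hubFive true]
  | high s => [hubHigh s]
  | hubFour s => [two s, three (!s), four]
  | hubFive s => [two s, three (!s), five]
  | hubHigh s => [two s, three s, high s]

/-- The free states: those around which a labelling may repeat a state. -/
def free : Pattern → Bool
  | four | five | high _ => true
  | _ => false

/-- `avoids k n a b` says that no walk in the pattern that starts with the step from `a` to `b`,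
makes at most `n` further steps and turns back only at free states, meets the colour `k` after
`a`. -/
def avoids (k : ℕ) : ℕ → Pattern → Pattern → Bool
  | 0, _, b => b.color ≠ k
  | n + 1, a, b =>
    decide (b.color ≠ k) && b.nbrs.all fun c => (decide (c = a) && !b.free) || avoids k n b c

lemma one_le_color (a : Pattern) : 1 ≤ a.color := by
  rcases a with s | s | _ | _ | s | s | s | s <;> (try cases s) <;> decide

lemma color_le_seven (a : Pattern) : a.color ≤ 7 := by
  rcases a with s | s | _ | _ | s | s | s | s <;> (try cases s) <;> decide

lemma mem_nbrs_symm {a b : Pattern} (h : b ∈ a.nbrs) : a ∈ b.nbrs := by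
  have key : ∀ b ∈ a.nbrs, a ∈ b.nbrs := by
    rcases a with s | s | _ | _ | s | s | s | s <;> (try cases s) <;> decide
  exact key b h

lemma nbrs_ne_nil (a : Pattern) : a.nbrs ≠ [] := by
  cases a <;> simp [nbrs]

lemma card_nbrs_of_not_free {a : Pattern} (h : a.free = false) : a.nbrs.toFinset.card = 3 := by
  rcases a with s | s | _ | _ | s | s | s | s <;> (try cases s) <;> revert h <;> decide

/-- A walk in the pattern that turns back only at free states needs more than `i` steps between
two states of colour `i`. -/
lemma avoids_color {a b : Pattern} (h : b ∈ a.nbrs) : avoids a.color (a.color - 1) a b = true := by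
  have key : ∀ b ∈ a.nbrs, avoids a.color (a.color - 1) a b = true := by
    rcases a with s | s | _ | _ | s | s | s | s <;> (try cases s) <;> decide
  exact key b h

lemma color_ne_of_avoids {k n : ℕ} {a b : Pattern} (h : avoids k n a b = true) : b.color ≠ k := by
  cases n <;> simp_all [avoids]

lemma avoids_step {k n : ℕ} {a b c : Pattern} (h : avoids k (n + 1) a b = true) (hc : c ∈ b.nbrs)
    (hca : c = a → b.free = true) : avoids k n b c = true := by
  simp only [avoids, Bool.and_eq_true, List.all_eq_true, Bool.or_eq_true] at h
  rcases h.2 c hc with h | h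
  · simp_all
  · exact h

end Pattern

/-! ### Packing colourings of subcubic trees -/

variable {V : Type*} {G : SimpleGraph V}

/-- A labelling of the vertices by states of the pattern that respects adjacency and is injective
on the neighbours of every vertex, except possibly around vertices with a free state. -/
structure IsPatternLabelling (G : SimpleGraph V) (f : V → Pattern) : Prop where
  mem_nbrs : ∀ u v, G.Adj u v → f v ∈ (f u).nbrs
  free_of_eq : ∀ v u w, G.Adj v u → G.Adj v w → u ≠ w → f u = f w → (f v).free = true

/-- A path in a labelled graph is followed in the pattern: as it repeats no vertex, its image turns
back only at free states. -/
lemma IsPatternLabelling.color_ne {f : V → Pattern} (hf : G.IsPatternLabelling f) {k : ℕ}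
    {w v : V} (q : G.Walk w v) : ∀ {n : ℕ} {u : V}, G.Adj u w → q.IsPath → u ∉ q.support →
      q.length ≤ n → Pattern.avoids k n (f u) (f w) = true → (f v).color ≠ k := by
  induction q with
  | nil => exact fun _ _ _ _ h => Pattern.color_ne_of_avoids h
  | @cons w x v h q ih =>
    intro n u huw hq hu hn hk
    rw [Walk.cons_isPath_iff] at hq
    rw [Walk.support_cons, List.mem_cons, not_or] at hu
    rw [Walk.length_cons] at hn
    obtain ⟨m, rfl⟩ : ∃ m, n = m + 1 := ⟨n - 1, by omega⟩
    refine ih h hq.1 hq.2 (by omega) (Pattern.avoids_step hk (hf.mem_nbrs _ _ h) fun hxu => ?_)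
    exact hf.free_of_eq w x u h huw.symm (fun hx => hu.2 (hx ▸ q.start_mem_support)) hxu

theorem IsPatternLabelling.isPackingColoring {f : V → Pattern} (hf : G.IsPatternLabelling f) :
    G.IsPackingColoring 7 fun v => (f v).color := by
  refine ⟨fun v => ⟨(f v).one_le_color, (f v).color_le_seven⟩, fun u v huv hc => ?_⟩
  by_contra! hle
  obtain ⟨p, hp⟩ := exists_walk_of_edist_ne_top (ne_top_of_le_ne_top (ENat.natCast_ne_top _) hle)
  rw [← hp, Nat.cast_le] at hle
  classical
  have hlen := p.length_bypass_le_length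
  have hpath := p.bypass_isPath
  generalize p.bypass = q at hlen hpath
  cases q with
  | nil => exact huv rfl
  | cons h q =>
    rw [Walk.cons_isPath_iff] at hpath
    rw [Walk.length_cons] at hlen
    exact hf.color_ne q h hpath.1 hpath.2 (by omega)
      (Pattern.avoids_color (hf.mem_nbrs _ _ h)) hc.symm

/-- A labelling of a subcubic tree is built leaf by leaf. -/
theorem IsTree.exists_isPatternLabelling [Finite V] (hG : G.IsTree)
    (hdeg : ∀ v, (G.neighborSet v).ncard ≤ 3) : ∃ f, G.IsPatternLabelling f := by
  induction hn : Nat.card V generalizing V with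
  | zero =>
    have := hG.connected.nonempty
    exact absurd hn Nat.card_pos.ne'
  | succ n ih =>
    classical
    have := Fintype.ofFinite V
    rcases subsingleton_or_nontrivial V with hs | hs
    · exact ⟨fun _ => .four, fun u v h => absurd (Subsingleton.elim u v) h.ne,
        fun v u w _ _ h => absurd (Subsingleton.elim u w) h⟩
    obtain ⟨l, hl⟩ := hG.exists_vert_degree_one_of_nontrivial
    obtain ⟨w, hlw, hw⟩ := degree_eq_one_iff_existsUnique_adj.mp hl
    have hconn := hG.connected.induce_compl_singleton_of_degree_eq_one hl
    have hcard : Nat.card ({l}ᶜ : Set V) = n := by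
      rw [Nat.card_coe_set_eq]
      have := Set.ncard_add_ncard_compl ({l} : Set V)
      rw [Set.ncard_singleton] at this
      omega
    obtain ⟨f, hf⟩ := ih (G := G.induce ({l}ᶜ : Set V)) ⟨hconn, hG.isAcyclic.induce _⟩ (fun v => by
      refine le_trans ?_ (hdeg v)
      rw [← Set.ncard_image_of_injective _ Subtype.val_injective]
      refine Set.ncard_le_ncard ?_ (Set.toFinite _)
      rintro _ ⟨x, hx, rfl⟩
      exact hx) hcard
    have hwl : w ≠ l := hlw.ne'
    -- the state of the leaf: a neighbour of the state of `w` that is not used around `w`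
    obtain ⟨t, ht, htf⟩ : ∃ t ∈ (f ⟨w, hwl⟩).nbrs, ∀ x : ({l}ᶜ : Set V), G.Adj w x → f x = t →
        (f ⟨w, hwl⟩).free = true := by
      cases hfree : (f ⟨w, hwl⟩).free with
      | true =>
        obtain ⟨t, ht⟩ := List.exists_mem_of_ne_nil _ (f ⟨w, hwl⟩).nbrs_ne_nil
        exact ⟨t, ht, fun _ _ _ => rfl⟩
      | false =>
        let N : Finset ({l}ᶜ : Set V) := Finset.univ.filter fun x => G.Adj w x
        have hN : N.card < 3 := by
          have h1 : insert l (N.map (Function.Embedding.subtype _)) ⊆ G.neighborFinset w := by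
            intro x hx
            rw [Finset.mem_insert, Finset.mem_map] at hx
            rcases hx with rfl | ⟨y, hy, rfl⟩
            · simpa using hlw.symm
            · simpa [N] using hy
          have h2 := Finset.card_le_card h1
          rw [Finset.card_insert_of_notMem (by simp), Finset.card_map] at h2
          have h3 := hdeg w
          rw [← coe_neighborFinset, Set.ncard_coe_finset] at h3
          omega
        obtain ⟨t, ht, htN⟩ := Finset.exists_mem_notMem_of_card_lt_card
          (s := N.image f) (t := (f ⟨w, hwl⟩).nbrs.toFinset)
          (by rw [Pattern.card_nbrs_of_not_free hfree]; exact Finset.card_image_le.trans_lt hN)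
        refine ⟨t, List.mem_toFinset.mp ht, fun x hx hxt => absurd ?_ htN⟩
        exact Finset.mem_image.mpr ⟨x, by simpa [N] using hx, hxt⟩
    let g : V → Pattern := fun v => if h : v = l then t else f ⟨v, h⟩
    have gl : g l = t := by simp [g]
    have gf : ∀ v (h : v ≠ l), g v = f ⟨v, h⟩ := fun v h => by simp [g, h]
    refine ⟨g, fun u v huv => ?_, fun v u x hvu hvx hux h => ?_⟩
    · by_cases hu : u = l
      · subst hu
        obtain rfl := hw v huv
        rw [gl, gf v hwl]
        exact Pattern.mem_nbrs_symm ht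
      · by_cases hv : v = l
        · subst hv
          obtain rfl := hw u huv.symm
          rw [gl, gf u hwl]
          exact ht
        · rw [gf u hu, gf v hv]
          exact hf.mem_nbrs ⟨u, hu⟩ ⟨v, hv⟩ huv
    · by_cases hv : v = l
      · subst hv
        exact absurd ((hw u hvu).trans (hw x hvx).symm) hux
      · rw [gf v hv]
        by_cases hu : u = l
        · subst hu
          obtain rfl := hw v hvu.symm
          rw [gl, gf x hux.symm] at h
          exact htf ⟨x, hux.symm⟩ hvx h.symm
        · by_cases hx : x = l
          · subst hx
            obtain rfl := hw v hvx.symm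
            rw [gl, gf u hu] at h
            exact htf ⟨u, hu⟩ hvu h
          · rw [gf u hu, gf x hx] at h
            exact hf.free_of_eq ⟨v, hv⟩ ⟨u, hu⟩ ⟨x, hx⟩ hvu hvx
              (fun h => hux (congrArg Subtype.val h)) h

/-! ### Balls in subcubic graphs -/

/-- In a subcubic graph, at most `1 + 2 + ⋯ + 2 ^ n` vertices are reached from `b` by paths of length
at most `n` that avoid a given neighbour of `b`. -/
lemma exists_finset_of_path_avoiding [Fintype V] [DecidableRel G.Adj] (hdeg : ∀ v, G.degree v ≤ 3)
    (n : ℕ) : ∀ {a b : V}, G.Adj a b → ∃ S : Finset V, S.card + 1 ≤ 2 ^ (n + 1) ∧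
      ∀ v (q : G.Walk b v), q.IsPath → a ∉ q.support → q.length ≤ n → v ∈ S := by
  classical
  induction n with
  | zero =>
    intro a b _
    refine ⟨{b}, by simp, fun v q _ _ hq => ?_⟩
    rw [Walk.eq_of_length_eq_zero (Nat.le_zero.mp hq)]
    exact Finset.mem_singleton_self v
  | succ n ih =>
    intro a b hab
    choose! S hS hmem using fun c (h : G.Adj b c) => ih h
    refine ⟨insert b (((G.neighborFinset b).erase a).biUnion S), ?_, fun v q hq ha hn => ?_⟩
    · have h1 : ((G.neighborFinset b).erase a).card ≤ 2 := by
        rw [Finset.card_erase_of_mem (by simpa using hab.symm), card_neighborFinset_eq_degree]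
        have := hdeg b
        omega
      have h2 : (((G.neighborFinset b).erase a).biUnion S).card ≤
          ((G.neighborFinset b).erase a).card * (2 ^ (n + 1) - 1) := by
        refine Finset.card_biUnion_le_card_mul _ _ _ fun c hc => ?_
        have := hS c (by simpa using Finset.mem_of_mem_erase hc)
        omega
      have h3 := Finset.card_insert_le b (((G.neighborFinset b).erase a).biUnion S)
      have h4 := Nat.mul_le_mul_right (2 ^ (n + 1) - 1) h1
      have h5 : 1 ≤ 2 ^ (n + 1) := Nat.one_le_two_pow
      rw [pow_succ 2 (n + 1)]
      omega
    · cases q with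
      | nil => exact Finset.mem_insert_self _ _
      | @cons _ c _ h q =>
        rw [Walk.cons_isPath_iff] at hq
        rw [Walk.support_cons, List.mem_cons, not_or] at ha
        rw [Walk.length_cons] at hn
        refine Finset.mem_insert_of_mem (Finset.mem_biUnion.mpr ⟨c, ?_, ?_⟩)
        · exact Finset.mem_erase.mpr ⟨fun hc => ha.2 (hc ▸ q.start_mem_support), by simpa using h⟩
        · exact hmem c h v q hq.1 hq.2 (by omega)

/-- A ball of radius `3` in a subcubic graph has at most `1 + 3 + 6 + 12` vertices. -/
lemma exists_finset_of_length_le_three [Fintype V] [DecidableRel G.Adj]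
    (hdeg : ∀ v, G.degree v ≤ 3) (x : V) :
    ∃ S : Finset V, S.card ≤ 22 ∧ ∀ v (q : G.Walk x v), q.length ≤ 3 → v ∈ S := by
  classical
  choose! S hS hmem using fun c (h : G.Adj x c) => exists_finset_of_path_avoiding hdeg 2 h
  refine ⟨insert x ((G.neighborFinset x).biUnion S), ?_, fun v q hq => ?_⟩
  · have h1 : ((G.neighborFinset x).biUnion S).card ≤ (G.neighborFinset x).card * 7 := by
      refine Finset.card_biUnion_le_card_mul _ _ _ fun c hc => ?_
      have := hS c (by simpa using hc)
      omega
    have h2 := Finset.card_insert_le x ((G.neighborFinset x).biUnion S)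
    rw [card_neighborFinset_eq_degree] at h1
    have := hdeg x
    omega
  · have hlen := q.length_bypass_le_length
    have hpath := q.bypass_isPath
    generalize q.bypass = p at hlen hpath
    cases p with
    | nil => exact Finset.mem_insert_self _ _
    | @cons _ c _ h p =>
      rw [Walk.cons_isPath_iff] at hpath
      rw [Walk.length_cons] at hlen
      exact Finset.mem_insert_of_mem (Finset.mem_biUnion.mpr
        ⟨c, by simpa using h, hmem c h v p hpath.1 hpath.2 (by omega)⟩)

lemma exists_finset_near_edge [Fintype V] [DecidableRel G.Adj] (hdeg : ∀ v, G.degree v ≤ 3)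
    (e : Sym2 V) :
    ∃ S : Finset V, S.card ≤ 44 ∧ ∀ x ∈ e, ∀ v (q : G.Walk x v), q.length ≤ 3 → v ∈ S := by
  classical
  induction e with
  | _ x y =>
    obtain ⟨S, hS, hmemS⟩ := exists_finset_of_length_le_three hdeg x
    obtain ⟨S', hS', hmemS'⟩ := exists_finset_of_length_le_three hdeg y
    refine ⟨S ∪ S', (Finset.card_union_le _ _).trans (by omega), fun z hz v q hq => ?_⟩
    rcases Sym2.mem_iff.mp hz with rfl | rfl
    · exact Finset.mem_union_left _ (hmemS v q hq)
    · exact Finset.mem_union_right _ (hmemS' v q hq)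

/-! ### Correcting the colouring of a spanning tree -/

/-- A walk stays in the subgraph `T`, or it crosses an edge outside `T`. -/
lemma Walk.exists_walk_le_or_exists_not_adj (T : SimpleGraph V) {u v : V} (p : G.Walk u v) :
    (∃ q : T.Walk u v, q.length = p.length) ∨
      ∃ x y, G.Adj x y ∧ ¬ T.Adj x y ∧ ∃ (q₁ : G.Walk x u) (q₂ : G.Walk y v),
        q₁.length + q₂.length + 1 = p.length := by
  induction p with
  | nil => exact .inl ⟨.nil, rfl⟩
  | @cons u w v h p ih =>
    by_cases hT : T.Adj u w
    · rcases ih with ⟨q, hq⟩ | ⟨x, y, hxy, hTxy, q₁, q₂, hq⟩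
      · exact .inl ⟨.cons hT q, by simp [hq]⟩
      · refine .inr ⟨x, y, hxy, hTxy, q₁.concat h.symm, q₂, ?_⟩
        rw [Walk.length_concat, Walk.length_cons]
        omega
    · exact .inr ⟨u, w, h, hT, .nil, p, by simp⟩

/-- If `T` is a spanning subgraph with a packing `7`-colouring, the vertices close to an edge
outside `T` may be recoloured with new colours to give a packing colouring of the whole graph. -/
theorem exists_isPackingColoring_of_le [Fintype V] [DecidableRel G.Adj]
    (hdeg : ∀ v, G.degree v ≤ 3) {T : SimpleGraph V} {c : V → ℕ} (hc : T.IsPackingColoring 7 c) :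
    ∃ k ≤ 7 + 44 * (G.edgeSet \ T.edgeSet).ncard, ∃ c', G.IsPackingColoring k c' := by
  classical
  choose S hS hmem using exists_finset_near_edge hdeg
  let B : Finset V := (G.edgeSet \ T.edgeSet).toFinset.biUnion S
  have hB : B.card ≤ (G.edgeSet \ T.edgeSet).ncard * 44 := by
    rw [Set.ncard_eq_toFinset_card']
    exact Finset.card_biUnion_le_card_mul _ _ _ fun e _ => hS e
  let c' : V → ℕ := fun v => if h : v ∈ B then 8 + (B.equivFin ⟨v, h⟩ : ℕ) else c v
  have c'_mem : ∀ v (h : v ∈ B), c' v = 8 + (B.equivFin ⟨v, h⟩ : ℕ) := fun v h => by simp [c', h]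
  have c'_notMem : ∀ v, v ∉ B → c' v = c v := fun v h => by simp [c', h]
  refine ⟨7 + B.card, by omega, c', fun v => ?_, fun u v huv huv' => ?_⟩
  · by_cases hv : v ∈ B
    · rw [c'_mem v hv]
      have := (B.equivFin ⟨v, hv⟩).isLt
      omega
    · rw [c'_notMem v hv]
      have := hc.1 v
      omega
  · by_cases hu : u ∈ B <;> by_cases hv : v ∈ B
    · rw [c'_mem u hu, c'_mem v hv] at huv'
      have := B.equivFin.injective (Fin.ext (Nat.add_left_cancel huv'))
      exact absurd (congrArg Subtype.val this) huv
    · rw [c'_mem u hu, c'_notMem v hv] at huv'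
      have := hc.1 v
      omega
    · rw [c'_notMem u hu, c'_mem v hv] at huv'
      have := hc.1 u
      omega
    · rw [c'_notMem u hu, c'_notMem v hv] at huv'
      rw [c'_notMem u hu]
      by_contra! hle
      obtain ⟨p, hp⟩ := exists_walk_of_edist_ne_top (ne_top_of_le_ne_top (ENat.natCast_ne_top _) hle)
      rw [← hp, Nat.cast_le] at hle
      rcases p.exists_walk_le_or_exists_not_adj T with ⟨q, hq⟩ | ⟨x, y, hxy, hTxy, q₁, q₂, hq⟩
      · have h1 := (hc.2 u v huv huv').trans_le (edist_le q)
        rw [Nat.cast_lt] at h1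
        omega
      · have he : s(x, y) ∈ (G.edgeSet \ T.edgeSet).toFinset := by simp [hxy, hTxy]
        have hcu := (hc.1 u).2
        -- the two parts of the walk have total length at most `6`
        rcases le_or_gt q₁.length 3 with h | h
        · exact hu (Finset.mem_biUnion.mpr ⟨_, he, hmem _ x (Sym2.mem_mk_left x y) u q₁ h⟩)
        · exact hv (Finset.mem_biUnion.mpr
            ⟨_, he, hmem _ y (Sym2.mem_mk_right x y) v q₂ (by omega)⟩)

/-! ### Counting bounded faces -/

lemma OuterplanarDrawing.card_add_card_boundedFace [Finite V] (D : G.OuterplanarDrawing) :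
    Nat.card V + Nat.card D.BoundedFace = Nat.card G.edgeSet + 1 := by
  classical
  have : Finite D.toRotationSystem.Face := by
    have : Finite G.Dart := Finite.of_injective _ Dart.toProd_injective
    unfold RotationSystem.Face
    infer_instance
  have : Finite D.BoundedFace := Subtype.finite
  have h : Nat.card D.toRotationSystem.Face = Nat.card D.BoundedFace + 1 := by
    rw [← Nat.card_congr (Equiv.optionSubtypeNe D.outer)]
    exact Finite.card_option
  have := D.euler
  omega

lemma nine_add_mul_le (r : ℕ) : 9 + 44 * r ≤ 9 * 6 ^ r := by
  induction r with
  | zero => simp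
  | succ r ih =>
    rw [pow_succ]
    omega

end SimpleGraph

theorem theorem3p5 {V : Type*} [Fintype V] (G : SimpleGraph V) [DecidableRel G.Adj]
    (hconn : G.Connected) (hsub : ∀ v, G.degree v ≤ 3)
    (D : G.OuterplanarDrawing) (r : ℕ) (hr : Nat.card D.BoundedFace = r) :
    G.packingChromaticNumber ≤ ((9 * 6 ^ r - 2 : ℕ) : ℕ∞) := by
  classical
  obtain ⟨T, hTG, hT⟩ := hconn.exists_isTree_le
  obtain ⟨f, hf⟩ := hT.exists_isPatternLabelling fun v => by
    refine (Set.ncard_le_ncard (fun _ h => hTG h) (Set.toFinite _)).trans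
      (?_ : (G.neighborSet v).ncard ≤ 3)
    rw [← SimpleGraph.coe_neighborFinset, Set.ncard_coe_finset]
    exact hsub v
  obtain ⟨k, hk, c, hc⟩ := SimpleGraph.exists_isPackingColoring_of_le hsub hf.isPackingColoring
  have hr' : (G.edgeSet \ T.edgeSet).ncard = r := by
    have h1 := D.card_add_card_boundedFace
    have h2 := hT.card_edgeFinset
    have h3 := Set.ncard_sdiff_add_ncard_of_subset (SimpleGraph.edgeSet_subset_edgeSet.mpr hTG)
    rw [← SimpleGraph.coe_edgeFinset T, Set.ncard_coe_finset] at h3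
    rw [hr, Nat.card_coe_set_eq, Nat.card_eq_fintype_card] at h1
    rw [← SimpleGraph.coe_edgeFinset T]
    omega
  have hle := SimpleGraph.nine_add_mul_le r
  rw [hr'] at hk
  refine (iInf_le _ ⟨k, c, hc⟩).trans (Nat.cast_le.mpr (?_ : k ≤ 9 * 6 ^ r - 2))
  omega
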